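/- Let $\Phi$ be a homogeneous Poisson point process in the plane $\mathbb{R}^2$ with density $\lambda_0>0$ (the static base stations). A user moves along a straight line at constant speed $v>0$: it starts at a given point $p$ and at time $s\ge 0$ it is at $x(s)=p+vs(\cos\Theta,\sin\Theta)$, where the direction $\Theta$ is uniformly distributed on $[0,2\pi)$ and independent of $\Phi$. At each time the user is served by the base station nearest to it (nearest-neighbour association). For $t>0$ let $H(t)$ be the event that a handover occurs by time $t$, i.e. that for some $s\in[0,t)$ $$\operatorname*{arg\,min}_{y\in\Phi}\|y-x(s)\|\ \neq\ \operatorname*{arg\,min}_{y\in\Phi}\|y-x(t)\|.$$ Then $$\mathbb{P}[H(t)]=1-\frac{1}{2\pi}\int_0^\infty\!\!\int_0^{2\pi}2\pi\lambda_0 r\,\exp\Big(-\lambda_0\Big[r^2\big(\pi-\varphi_1+\tfrac12\sin 2\varphi_1\big)+R^2\big(\pi-\varphi_2+\tfrac12\sin 2\varphi_2\big)\Big]\Big)\,d\theta\,dr,$$ where the double integral converges absolutely and $$R=\sqrt{r^2+v^2t^2-2rvt\cos\theta},\qquad \varphi_1=\cos^{-1}\!\Big(\frac{v^2t^2+r^2-R^2}{2vtr}\Big),\qquad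 \varphi_2=\cos^{-1}\!\Big(\frac{v^2t^2+R^2-r^2}{2vtR}\Big).$$ -/

import Mathlib

open MeasureTheory ProbabilityTheory

/-- The Euclidean plane, with its Euclidean distance and Lebesgue measure `volume`. -/
abbrev Plane : Type := EuclideanSpace ℝ (Fin 2)

/-- A locally finite configuration of points of the plane:
only finitely many points lie in each bounded set. -/
structure PointConfig : Type where
  pts : Set Plane
  locallyFinite : ∀ B : Set Plane, Bornology.IsBounded B → (pts ∩ B).Finite

/-- The number `N(B)` of points of the configuration in the set `B`. -/
noncomputable def PointConfig.count (B : Set Plane) (S : PointConfig) : ℕ∞ :=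
  (S.pts ∩ B).encard

/-- The usual σ-algebra on configurations: the smallest one that makes the counts `N(B)` of all
Borel sets `B` measurable. -/
noncomputable instance PointConfig.instMeasurableSpace : MeasurableSpace PointConfig :=
  ⨆ (B : Set Plane) (_ : MeasurableSet B), MeasurableSpace.comap (PointConfig.count B) inferInstance

/-- `Φ` is a homogeneous Poisson point process on the plane with density `lam`: it is a random
configuration, the number of points in a Borel set of finite area `a` is Poisson with mean
`lam * a`, and the numbers of points in finitely many disjoint Borel sets are independent. -/
structure IsHomogeneousPPP {Ω : Type*} [MeasurableSpace Ω] (lam : ℝ) (Φ : Ω → PointConfig)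
    (P : Measure Ω) : Prop where
  measurable : Measurable Φ
  poisson : ∀ B : Set Plane, MeasurableSet B → volume B < ⊤ → ∀ n : ℕ,
    P {ω | (Φ ω).count B = n} = poissonMeasure (lam * volume.real B).toNNReal {n}
  indep : ∀ (k : ℕ) (B : Fin k → Set Plane), (∀ i, MeasurableSet (B i)) →
    Pairwise (fun i j => Disjoint (B i) (B j)) → iIndepFun (fun i ω => (Φ ω).count (B i)) P

/-- The set of serving base stations of a user at `u` under nearest-neighbour association: all
minimizers of the distance to `u` among the points of the configuration. -/
def PointConfig.serving (S : PointConfig) (u : Plane) : Set Plane :=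
  {x | x ∈ S.pts ∧ ∀ y ∈ S.pts, dist x u ≤ dist y u}

/-- Position at time `s` of a user that starts at `p` and moves along a straight line with
constant speed `v` in the direction `θ`. -/
noncomputable def uePosition (p : Plane) (v θ s : ℝ) : Plane :=
  p + (v * s) • !₂[Real.cos θ, Real.sin θ]

/-- The event `H(t)` that the serving base station at some time `s` with `0 ≤ s < t` differs from
the one at time `t`. -/
def handoverEvent {Ω : Type*} (Φ : Ω → PointConfig) (Θ : Ω → ℝ) (p : Plane) (v t : ℝ) : Set Ω :=
  {ω | ∃ s : ℝ, 0 ≤ s ∧ s < t ∧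
    (Φ ω).serving (uePosition p v (Θ ω) s) ≠ (Φ ω).serving (uePosition p v (Θ ω) t)}

/-- The distance `R` at time `t` to a station that is initially at distance `r`, where `θ` is the
angle between the direction of motion and the initial direction to the station. -/
noncomputable def handoverR (v t r θ : ℝ) : ℝ :=
  Real.sqrt (r ^ 2 + v ^ 2 * t ^ 2 - 2 * r * v * t * Real.cos θ)

/-- The angle `φ₁`. -/
noncomputable def handoverPhi₁ (v t r θ : ℝ) : ℝ :=
  Real.arccos ((v ^ 2 * t ^ 2 + r ^ 2 - handoverR v t r θ ^ 2) / (2 * v * t * r))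

/-- The angle `φ₂`. -/
noncomputable def handoverPhi₂ (v t r θ : ℝ) : ℝ :=
  Real.arccos ((v ^ 2 * t ^ 2 + handoverR v t r θ ^ 2 - r ^ 2) / (2 * v * t * handoverR v t r θ))

/-- The integrand of the handover probability formula. -/
noncomputable def handoverIntegrand (lam v t r θ : ℝ) : ℝ :=
  2 * Real.pi * lam * r * Real.exp (-lam *
    (r ^ 2 * (Real.pi - handoverPhi₁ v t r θ + 1 / 2 * Real.sin (2 * handoverPhi₁ v t r θ))
      + handoverR v t r θ ^ 2 *
        (Real.pi - handoverPhi₂ v t r θ + 1 / 2 * Real.sin (2 * handoverPhi₂ v t r θ))))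

/-! Write a for the starting point p and b for the position at time t. The points closer to one
station than to another form a convex half-plane, so a station strictly nearest to both a and b
serves the whole segment and there is no handover. Conversely, a almost surely has a unique nearest
station; if the serving sets at a and b agree, that station is strictly nearest to b as well. Up to
a null set, the complement of the handover event is therefore `HasCommonNearest`
(`handoverEvent_ae_eq`).

A station at y is the common nearest one exactly when, apart from boundary circles, the union D(y)
of the discs about a and b through y contains no other station. This suggests the probability ∫ λ
exp(-λ|D(y)|) dy, an instance of the Mecke formula. `measure_hasCommonNearest` derives it from the
counts alone: the plane is cut into cells of radius δ, the event is sandwiched between events about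
one cell and slightly shrunk or enlarged discs, and δ tends to 0 under a Gaussian bound.

The common chord of the two circles splits D(y) into two disc segments, whose areas give the terms
in φ₁ and φ₂ (`Complex.volume_real_ball_union_ball`). Rotating the direction of motion to the real
axis and passing to polar coordinates gives the double integral, the same for every direction
(`lintegral_twoDiscs_eq`). Independence allows conditioning on the direction. Absolute convergence
follows because the integral of the nonnegative integrand is 2π times a probability. -/

namespace PointConfig

/-! ### Common nearest points: discretisation and measurability -/

/-- Some point of `S` is strictly nearer than all others to `a` as well as to `b`. -/
def HasCommonNearest (S : PointConfig) (a b : Plane) : Prop :=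
  ∃ y ∈ S.pts, ∀ z ∈ S.pts, z ≠ y → dist y a < dist z a ∧ dist y b < dist z b

/-- The union of the discs about `a` and `b` whose radii exceed the distances to `y` by `s`. -/
def twoDiscs (a b y : Plane) (s : ℝ) : Set Plane :=
  Metric.ball a (dist y a + s) ∪ Metric.ball b (dist y b + s)

lemma measurableSet_twoDiscs (a b y : Plane) (s : ℝ) : MeasurableSet (twoDiscs a b y s) :=
  Metric.isOpen_ball.measurableSet.union Metric.isOpen_ball.measurableSet

lemma mem_twoDiscs {a b y z : Plane} {s : ℝ} :
    z ∈ twoDiscs a b y s ↔ dist z a < dist y a + s ∨ dist z b < dist y b + s := Iff.rfl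

/-- This controls replacing y and b by nearby cell centres. Moving b by `e` costs `2 * e`: once in
the radius `dist y b`, once in the centre of the disc. The centre a never moves. -/
lemma twoDiscs_subset {a b b' y y' : Plane} {s s' d e : ℝ} (hd : dist y y' ≤ d)
    (he : dist b b' ≤ e) (he0 : 0 ≤ e) (hs : s + d + 2 * e ≤ s') :
    twoDiscs a b y s ⊆ twoDiscs a b' y' s' := by
  intro z hz
  rw [mem_twoDiscs] at hz ⊢
  refine hz.imp (fun h => ?_) (fun h => ?_)
  · have := dist_triangle y y' a
    linarith
  · have h1 := dist_triangle y y' b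
    have h2 := dist_triangle y' b' b
    have h3 := dist_triangle z b b'
    rw [dist_comm b' b] at h2
    linarith

lemma measurable_count {B : Set Plane} (hB : MeasurableSet B) :
    Measurable (PointConfig.count B) := by
  refine Measurable.mono (comap_measurable _) ?_ le_rfl
  exact le_iSup₂_of_le B hB le_rfl

lemma count_eq_zero {S : PointConfig} {B : Set Plane} :
    S.count B = 0 ↔ ∀ z ∈ S.pts, z ∉ B := by
  rw [count, Set.encard_eq_zero, Set.eq_empty_iff_forall_notMem]
  simp

lemma count_eq_one {S : PointConfig} {B : Set Plane} :
    S.count B = 1 ↔ ∃ y ∈ S.pts, y ∈ B ∧ ∀ z ∈ S.pts, z ∈ B → z = y := by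
  rw [count, Set.encard_eq_one]
  constructor
  · rintro ⟨y, hy⟩
    have : y ∈ S.pts ∩ B := by rw [hy]; rfl
    refine ⟨y, this.1, this.2, fun z hz hzB => ?_⟩
    have h : z ∈ S.pts ∩ B := ⟨hz, hzB⟩
    rwa [hy] at h
  · rintro ⟨y, hy, hyB, h⟩
    refine ⟨y, Set.eq_singleton_iff_unique_mem.2 ⟨⟨hy, hyB⟩, fun z hz => h z hz.1 hz.2⟩⟩

/-- By local finiteness, a common strictly nearest point wins by a positive margin. -/
lemma HasCommonNearest.exists_margin {S : PointConfig} {a b : Plane}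
    (h : S.HasCommonNearest a b) :
    ∃ ε > 0, ∃ y ∈ S.pts, ∀ z ∈ S.pts, z ≠ y → z ∉ twoDiscs a b y ε := by
  obtain ⟨y, hy, h⟩ := h
  -- Only the finitely many rivals inside the discs enlarged by 1 can have a margin below 1, so the
  -- minimum over them decides.
  set T := {z ∈ S.pts | z ≠ y ∧ z ∈ twoDiscs a b y 1} with hT
  have hfin : T.Finite := by
    refine (S.locallyFinite (twoDiscs a b y 1)
      (Metric.isBounded_ball.union Metric.isBounded_ball)).subset ?_
    rintro z ⟨h1, -, h2⟩
    exact ⟨h1, h2⟩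
  rcases T.eq_empty_or_nonempty with h0 | hne
  · refine ⟨1, one_pos, y, hy, fun z hz hzy hzD => ?_⟩
    have : z ∈ T := ⟨hz, hzy, hzD⟩
    simp [h0] at this
  · obtain ⟨w, hw, hmin⟩ := Set.exists_min_image T
      (fun z => min (dist z a - dist y a) (dist z b - dist y b)) hfin hne
    obtain ⟨h1, h2⟩ := h w hw.1 hw.2.1
    refine ⟨min 1 (min (dist w a - dist y a) (dist w b - dist y b)), ?_, y, hy, ?_⟩
    · simp [h1, h2]
    · intro z hz hzy hzD
      have hzT : z ∈ T := by
        refine ⟨hz, hzy, ?_⟩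
        rw [mem_twoDiscs] at hzD ⊢
        have := min_le_left 1 (min (dist w a - dist y a) (dist w b - dist y b))
        exact hzD.imp (fun h => by linarith) (fun h => by linarith)
      have h3 := hmin z hzT
      have h4 := min_le_right 1 (min (dist w a - dist y a) (dist w b - dist y b))
      have h5 := min_le_left (dist z a - dist y a) (dist z b - dist y b)
      have h6 := min_le_right (dist z a - dist y a) (dist z b - dist y b)
      rcases mem_twoDiscs.1 hzD with h | h <;> linarith

/-- The cell `C`, close to `c`, contains exactly one point, and there is no other point in the two
discs for `c`, enlarged by `s`. -/
def IsolatedIn (S : PointConfig) (a b c : Plane) (s : ℝ) (C : Set Plane) : Prop :=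
  S.count C = 1 ∧ S.count (twoDiscs a b c s \ C) = 0

/-- The only point of the cell is at most `δ` farther from a and b' than c is, while every other
point is at least `s` farther than c. Passing from b' to b costs `e` on either side, hence the
threshold `δ + 2 * e`. -/
lemma IsolatedIn.exists_nearest {S : PointConfig} {a b b' c : Plane} {δ e s : ℝ} {C : Set Plane}
    (h : S.IsolatedIn a b' c s C) (hC : C ⊆ Metric.closedBall c δ) (hb : dist b b' ≤ e)
    (he : 0 ≤ e) (hs : δ + 2 * e < s) :
    ∃ y ∈ S.pts, y ∈ C ∧ ∀ z ∈ S.pts, z ≠ y → dist y a < dist z a ∧ dist y b < dist z b := by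
  obtain ⟨h1, h0⟩ := h
  obtain ⟨y, hy, hyC, hu⟩ := count_eq_one.1 h1
  refine ⟨y, hy, hyC, fun z hz hzy => ?_⟩
  have hz1 : z ∉ twoDiscs a b' c s := fun h' =>
    count_eq_zero.1 h0 z hz ⟨h', fun hzC => hzy (hu z hz hzC)⟩
  have hyc : dist y c ≤ δ := hC hyC
  rw [mem_twoDiscs, not_or, not_lt, not_lt] at hz1
  have t1 := dist_triangle y c a
  have t2 := dist_triangle y c b
  have t3 := dist_triangle c b' b
  have t4 := dist_triangle z b b'
  rw [dist_comm b' b] at t3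
  constructor <;> linarith

/-- A partition of the plane into countably many small measurable cells. -/
lemma exists_cells {δ : ℝ} (hδ : 0 < δ) :
    ∃ (f : Plane → ℕ) (c : ℕ → Plane), Measurable f ∧ ∀ y, dist y (c (f y)) ≤ δ := by
  classical
  have hp : ∀ y : Plane, ∃ k, dist y (TopologicalSpace.denseSeq Plane k) < δ := by
    intro y
    obtain ⟨k, hk⟩ := (TopologicalSpace.denseRange_denseSeq Plane).exists_dist_lt y hδ
    exact ⟨k, hk⟩
  -- The cell index is the first term of a dense sequence within `δ` of the point.
  refine ⟨fun y => Nat.find (hp y), TopologicalSpace.denseSeq Plane, ?_, fun y => ?_⟩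
  · exact measurable_find hp fun k => measurableSet_lt (by fun_prop) measurable_const
  · exact (Nat.find_spec (hp y)).le

lemma measurableSet_isolatedIn (a b c : Plane) (s : ℝ) {C : Set Plane} (hC : MeasurableSet C) :
    MeasurableSet {S : PointConfig | S.IsolatedIn a b c s C} :=
  (measurable_count hC (measurableSet_singleton 1)).inter
    (measurable_count ((measurableSet_twoDiscs a b c s).diff hC) (measurableSet_singleton 0))

/-- Measurability is needed jointly in the second location and the configuration, since that
location will be random. Rounding both the station and the location to cells writes the set as a
countable union of rectangles. -/
lemma measurableSet_hasCommonNearest (a : Plane) :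
    MeasurableSet {q : Plane × PointConfig | q.2.HasCommonNearest a q.1} := by
  have hδ : ∀ n : ℕ, (0 : ℝ) < 1 / (n + 1) := fun n => by positivity
  choose f c hf hc using fun n : ℕ => exists_cells (hδ n)
  have key : {q : Plane × PointConfig | q.2.HasCommonNearest a q.1} =
      ⋃ n : ℕ, ⋃ i : ℕ, ⋃ j : ℕ, (f n ⁻¹' {j}) ×ˢ
        {S : PointConfig | S.IsolatedIn a (c n j) (c n i) (4 * (1 / (n + 1))) (f n ⁻¹' {i})} := by
    ext ⟨b, S⟩
    simp only [Set.mem_ofPred_eq, Set.mem_iUnion, Set.mem_prod, Set.mem_preimage,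
      Set.mem_singleton_iff]
    constructor
    · intro h
      obtain ⟨ε, hε, y, hy, h⟩ := h.exists_margin
      -- With δ = 1/(n+1), the enlargement 4δ exceeds the δ + 2δ required by
      -- `IsolatedIn.exists_nearest`. Moving the discs from cell centres to y and b adds 3δ, and 7δ
      -- < ε stays within the margin.
      obtain ⟨n, hn⟩ := exists_nat_one_div_lt (show 0 < ε / 7 by positivity)
      have hcell : f n ⁻¹' {f n y} ⊆ twoDiscs a b y ε := by
        intro z hz
        have h1 := hc n z
        rw [show f n z = f n y from hz] at h1
        have h2 := hc n y
        have h3 := dist_triangle z (c n (f n y)) y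
        have h4 := dist_triangle z y a
        rw [dist_comm (c n (f n y)) y] at h3
        refine Or.inl ?_
        rw [Metric.mem_ball]
        linarith
      refine ⟨n, f n y, f n b, rfl, count_eq_one.2 ⟨y, hy, rfl, fun z hz hzC => ?_⟩,
        count_eq_zero.2 fun z hz hzD => ?_⟩
      · by_contra hne
        exact h z hz hne (hcell hzC)
      · have hne : z ≠ y := by
          rintro rfl
          exact hzD.2 rfl
        refine h z hz hne (twoDiscs_subset (d := 1 / (n + 1)) (e := 1 / (n + 1)) ?_ ?_ (hδ n).le
          ?_ hzD.1)
        · rw [dist_comm]; exact hc n y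
        · rw [dist_comm]; exact hc n b
        · linarith
    · rintro ⟨n, i, j, hb, h⟩
      obtain ⟨y, hy, -, h⟩ := h.exists_nearest (δ := 1 / (n + 1)) (e := 1 / (n + 1)) (b := b)
        (fun z hz => by
          have := hc n z
          rwa [show f n z = i from hz] at this)
        (by have := hc n b; rwa [hb] at this) (hδ n).le (by linarith [hδ n])
      exact ⟨y, hy, h⟩
  rw [key]
  refine MeasurableSet.iUnion fun n => MeasurableSet.iUnion fun i => MeasurableSet.iUnion fun j =>
    (hf n (measurableSet_singleton j)).prod
      (measurableSet_isolatedIn _ _ _ _ (hf n (measurableSet_singleton i)))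

/-! ### Serving stations along the segment -/

lemma serving_eq_singleton {S : PointConfig} {y u : Plane} (hy : y ∈ S.pts)
    (h : ∀ z ∈ S.pts, z ≠ y → dist y u < dist z u) : S.serving u = {y} := by
  ext x
  constructor
  · rintro ⟨hx, hmin⟩
    by_contra hne
    exact (h x hx hne).not_ge (hmin y hy)
  · rintro rfl
    refine ⟨hy, fun z hz => ?_⟩
    rcases eq_or_ne z x with rfl | hne
    · exact le_rfl
    · exact (h z hz hne).le

/-- If serving sets agree and `a` has a unique nearest point, it is nearest to `b` too. -/
lemma hasCommonNearest_of_serving_eq {S : PointConfig} {a b : Plane}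
    (ha : S.HasCommonNearest a a) (hab : S.serving a = S.serving b) : S.HasCommonNearest a b := by
  obtain ⟨y, hy, h⟩ := ha
  have hb : S.serving b = {y} := by
    rw [← hab]
    exact serving_eq_singleton hy fun z hz hzy => (h z hz hzy).1
  refine ⟨y, hy, fun z hz hzy => ⟨(h z hz hzy).1, ?_⟩⟩
  have hyb : y ∈ S.serving b := by rw [hb]; rfl
  refine (hyb.2 z hz).lt_of_ne fun heq => hzy ?_
  have : z ∈ S.serving b := ⟨hz, fun w hw => heq ▸ hyb.2 w hw⟩
  rwa [hb] at this

end PointConfig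

/-- Half-planes bounded by a perpendicular bisector are convex. -/
lemma dist_lt_dist_uePosition {p y z : Plane} {v θ s t : ℝ} (hs : 0 ≤ s) (hst : s ≤ t)
    (h0 : dist y p < dist z p) (ht : dist y (uePosition p v θ t) < dist z (uePosition p v θ t)) :
    dist y (uePosition p v θ s) < dist z (uePosition p v θ s) := by
  rw [EuclideanSpace.dist_eq, EuclideanSpace.dist_eq,
    Real.sqrt_lt_sqrt_iff (Finset.sum_nonneg fun _ _ => sq_nonneg _)] at h0 ht ⊢
  simp only [uePosition, Fin.sum_univ_two, Real.dist_eq, sq_abs, PiLp.add_apply, PiLp.smul_apply,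
    smul_eq_mul, Matrix.cons_val_zero, Matrix.cons_val_one, Fin.isValue] at h0 ht ⊢
  rcases hs.eq_or_lt with rfl | hs
  · simpa using h0
  -- The difference of squared distances to z and y at time s is `A + s * B`: the quadratic terms in
  -- s cancel. An affine function positive at 0 and t is positive in between.
  set A := (z 0 - p 0) ^ 2 + (z 1 - p 1) ^ 2 - (y 0 - p 0) ^ 2 - (y 1 - p 1) ^ 2 with hA
  set B := 2 * v * ((y 0 - z 0) * Real.cos θ + (y 1 - z 1) * Real.sin θ) with hB
  have hA0 : 0 < A := by rw [hA]; linarith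
  have ht' : 0 < A + t * B := by rw [hA, hB]; linarith
  have key : 0 < A + s * B := by
    have : 0 < t * (A + s * B) := by
      have e : t * (A + s * B) = (t - s) * A + s * (A + t * B) := by ring
      rw [e]
      have := mul_pos hs ht'
      have := mul_nonneg (sub_nonneg.2 hst) hA0.le
      linarith
    exact pos_of_mul_pos_right this (hs.le.trans hst)
  rw [hA, hB] at key
  linarith

lemma PointConfig.HasCommonNearest.serving_uePosition_eq {S : PointConfig} {p : Plane}
    {v θ s t : ℝ} (h : S.HasCommonNearest p (uePosition p v θ t))
    (hs : 0 ≤ s) (hst : s ≤ t) :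
    S.serving (uePosition p v θ s) = S.serving (uePosition p v θ t) := by
  obtain ⟨y, hy, h⟩ := h
  rw [serving_eq_singleton hy fun z hz hzy =>
      dist_lt_dist_uePosition hs hst (h z hz hzy).1 (h z hz hzy).2,
    serving_eq_singleton hy fun z hz hzy => (h z hz hzy).2]

/-! ### Area of the two discs: continuity in the radius and domination -/

namespace PointConfig

lemma isBounded_twoDiscs (a b y : Plane) (s : ℝ) : Bornology.IsBounded (twoDiscs a b y s) :=
  Metric.isBounded_ball.union Metric.isBounded_ball

lemma volume_twoDiscs_ne_top (a b y : Plane) (s : ℝ) : volume (twoDiscs a b y s) ≠ ⊤ :=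
  (isBounded_twoDiscs a b y s).measure_lt_top.ne

lemma measurable_volume_twoDiscs (a b : Plane) (s : ℝ) :
    Measurable fun y => volume.real (twoDiscs a b y s) := by
  have hopen : IsOpen ({q : Plane × Plane | dist q.2 a < dist q.1 a + s} ∪
      {q : Plane × Plane | dist q.2 b < dist q.1 b + s}) :=
    (isOpen_lt (by fun_prop) (by fun_prop)).union (isOpen_lt (by fun_prop) (by fun_prop))
  exact (measurable_measure_prodMk_left hopen.measurableSet).ennreal_toReal

lemma volume_real_ball (x : Plane) (r : ℝ) :
    volume.real (Metric.ball x r) = Real.pi * (max r 0) ^ 2 := by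
  rw [measureReal_def, EuclideanSpace.volume_ball_fin_two, ENNReal.toReal_mul, ENNReal.toReal_pow,
    ENNReal.toReal_ofReal', ENNReal.toReal_ofReal Real.pi_pos.le, mul_comm]

/-- The union grows by no more than the two discs do separately. The disc areas are explicit, so
continuity follows without a formula for the union. -/
lemma volume_real_twoDiscs_le (a b y : Plane) {s s' : ℝ} (h : s ≤ s') :
    volume.real (twoDiscs a b y s') ≤ volume.real (twoDiscs a b y s) +
      ((volume.real (Metric.ball a (dist y a + s')) + volume.real (Metric.ball b (dist y b + s'))) -
      (volume.real (Metric.ball a (dist y a + s)) + volume.real (Metric.ball b (dist y b + s)))) := by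
  have hd : ∀ c : Plane, volume.real (Metric.ball c (dist y c + s') \ Metric.ball c (dist y c + s)) =
      volume.real (Metric.ball c (dist y c + s')) - volume.real (Metric.ball c (dist y c + s)) :=
    fun c => measureReal_sdiff (Metric.ball_subset_ball (by linarith))
      Metric.isOpen_ball.measurableSet
  have hsub : twoDiscs a b y s' ⊆ twoDiscs a b y s ∪
      ((Metric.ball a (dist y a + s') \ Metric.ball a (dist y a + s)) ∪
      (Metric.ball b (dist y b + s') \ Metric.ball b (dist y b + s))) := by
    intro z hz
    by_cases hz' : z ∈ twoDiscs a b y s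
    · exact Or.inl hz'
    · simp only [twoDiscs, Set.mem_union, not_or] at hz'
      exact Or.inr (hz.imp (fun h => ⟨h, hz'.1⟩) (fun h => ⟨h, hz'.2⟩))
  have hfin : ∀ c : Plane,
      volume (Metric.ball c (dist y c + s') \ Metric.ball c (dist y c + s)) ≠ ⊤ :=
    fun c => (Metric.isBounded_ball.subset Set.sdiff_subset).measure_lt_top.ne
  calc volume.real (twoDiscs a b y s') ≤ _ := measureReal_mono hsub
        (measure_union_lt_top (volume_twoDiscs_ne_top a b y s).lt_top
          (measure_union_lt_top (hfin a).lt_top (hfin b).lt_top)).ne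
    _ ≤ _ := measureReal_union_le _ _
    _ ≤ _ := by
      have := measureReal_union_le (μ := volume)
        (Metric.ball a (dist y a + s') \ Metric.ball a (dist y a + s))
        (Metric.ball b (dist y b + s') \ Metric.ball b (dist y b + s))
      rw [hd, hd] at this
      linarith

lemma twoDiscs_mono (a b y : Plane) {s s' : ℝ} (h : s ≤ s') :
    twoDiscs a b y s ⊆ twoDiscs a b y s' :=
  twoDiscs_subset (d := 0) (e := 0) (by simp) (by simp) le_rfl (by linarith)

lemma continuousAt_volume_twoDiscs (a b y : Plane) :
    Filter.Tendsto (fun s => volume.real (twoDiscs a b y s)) (nhds 0)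
      (nhds (volume.real (twoDiscs a b y 0))) := by
  set h : ℝ → ℝ := fun s =>
    volume.real (Metric.ball a (dist y a + s)) + volume.real (Metric.ball b (dist y b + s)) with hh
  have hcont : Continuous h := by
    simp only [hh, volume_real_ball]
    fun_prop
  have hlim : Filter.Tendsto (fun s => |h s - h 0|) (nhds 0) (nhds 0) := by
    have := ((hcont.sub continuous_const).abs (f := fun s => h s - h 0)).tendsto 0
    simpa using this
  rw [tendsto_iff_dist_tendsto_zero]
  refine squeeze_zero (fun _ => dist_nonneg) (fun s => ?_) hlim
  rw [Real.dist_eq]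
  rcases le_total s 0 with hs | hs
  · have h1 := volume_real_twoDiscs_le a b y hs
    have h2 := measureReal_mono (μ := volume) (twoDiscs_mono a b y hs) (volume_twoDiscs_ne_top a b y 0)
    rw [abs_of_nonpos (by linarith), abs_sub_comm]
    refine le_trans ?_ (le_abs_self _)
    simp only [hh]
    linarith
  · have h1 := volume_real_twoDiscs_le a b y hs
    have h2 := measureReal_mono (μ := volume) (twoDiscs_mono a b y hs) (volume_twoDiscs_ne_top a b y s)
    rw [abs_of_nonneg (by linarith)]
    refine le_trans ?_ (le_abs_self _)
    simp only [hh]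
    linarith

lemma integrable_exp_neg_mul_dist_sq {c : ℝ} (hc : 0 < c) (a : Plane) :
    Integrable fun y : Plane => Real.exp (-c * dist y a ^ 2) := by
  have h : Integrable fun y : Plane => Real.exp (-c * ‖y‖ ^ 2) := by
    refine Integrable.of_integral_ne_zero ?_
    rw [GaussianFourier.integral_rexp_neg_mul_sq_norm hc]
    positivity
  simpa only [dist_eq_norm] using h.comp_sub_right a

/-- This gives the integrable Gaussian bound, uniform over `s ≥ -2`. For distances ρ ≥ 2 it rests on
(ρ - 2)² - (ρ²/2 - 4) = (ρ - 4)²/2; for ρ ≤ 2 the left-hand side is negative. -/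
lemma le_volume_twoDiscs (a b y : Plane) {s : ℝ} (hs : -2 ≤ s) :
    Real.pi * (dist y a ^ 2 / 2 - 4) ≤ volume.real (twoDiscs a b y s) := by
  calc Real.pi * (dist y a ^ 2 / 2 - 4) ≤ Real.pi * (max (dist y a + s) 0) ^ 2 := by
        refine mul_le_mul_of_nonneg_left ?_ Real.pi_pos.le
        have h0 : 0 ≤ dist y a := dist_nonneg
        rcases le_total 2 (dist y a) with h | h
        · have : dist y a - 2 ≤ max (dist y a + s) 0 := le_max_of_le_left (by linarith)
          have := pow_le_pow_left₀ (by linarith) this 2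
          nlinarith [sq_nonneg (dist y a - 4)]
        · nlinarith [sq_nonneg (max (dist y a + s) 0)]
    _ = volume.real (Metric.ball a (dist y a + s)) := (volume_real_ball _ _).symm
    _ ≤ _ := measureReal_mono Set.subset_union_left (volume_twoDiscs_ne_top a b y s)

lemma tendsto_lintegral_twoDiscs {lam : ℝ} (hlam : 0 < lam) (a b : Plane) {s k : ℕ → ℝ} {K : ℝ}
    (hs : Filter.Tendsto s Filter.atTop (nhds 0)) (hs2 : ∀ n, -2 ≤ s n)
    (hk : Filter.Tendsto k Filter.atTop (nhds 1)) (hk0 : ∀ n, 0 ≤ k n) (hkK : ∀ n, k n ≤ K) :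
    Filter.Tendsto (fun n => ∫⁻ y : Plane, ENNReal.ofReal
        (lam * k n * Real.exp (-lam * volume.real (twoDiscs a b y (s n))))) Filter.atTop
      (nhds (∫⁻ y : Plane, ENNReal.ofReal
        (lam * Real.exp (-lam * volume.real (twoDiscs a b y 0))))) := by
  refine tendsto_lintegral_of_dominated_convergence
    (fun y => ENNReal.ofReal (lam * K * Real.exp (4 * lam * Real.pi) *
      Real.exp (-(lam * Real.pi / 2) * dist y a ^ 2))) ?_ ?_ ?_ ?_
  · intro n
    have := measurable_volume_twoDiscs a b (s n)
    fun_prop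
  · intro n
    refine Filter.Eventually.of_forall fun y => ENNReal.ofReal_le_ofReal ?_
    rw [mul_assoc (lam * K), ← Real.exp_add]
    refine mul_le_mul (mul_le_mul_of_nonneg_left (hkK n) hlam.le) (Real.exp_le_exp.2 ?_)
      (Real.exp_pos _).le (mul_nonneg hlam.le ((hk0 n).trans (hkK n)))
    have := mul_le_mul_of_nonneg_left (le_volume_twoDiscs a b y (hs2 n)) hlam.le
    linarith
  · exact ((integrable_exp_neg_mul_dist_sq (by positivity) a).const_mul _).lintegral_lt_top.ne
  · refine Filter.Eventually.of_forall fun y => ?_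
    have h1 := (continuousAt_volume_twoDiscs a b y).comp hs
    have h2 := ((hk.const_mul lam).mul ((h1.const_mul (-lam)).rexp))
    rw [mul_one] at h2
    exact (ENNReal.continuous_ofReal.tendsto _).comp h2

end PointConfig

/-! ### Poisson probabilities for one or two regions -/

open PointConfig

namespace IsHomogeneousPPP

variable {Ω : Type*} [MeasurableSpace Ω] {P : Measure Ω} {lam : ℝ} {Φ : Ω → PointConfig}

lemma measure_count_eq_zero (hΦ : IsHomogeneousPPP lam Φ P) (hlam : 0 ≤ lam) {B : Set Plane}
    (hB : MeasurableSet B) (hfin : volume B ≠ ⊤) :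
    P {ω | (Φ ω).count B = 0} = ENNReal.ofReal (Real.exp (-lam * volume.real B)) := by
  have := hΦ.poisson B hB hfin.lt_top 0
  rw [poissonMeasure_singleton, Real.coe_toNNReal _ (mul_nonneg hlam measureReal_nonneg)] at this
  simpa using this

lemma measure_count_eq_one (hΦ : IsHomogeneousPPP lam Φ P) (hlam : 0 ≤ lam) {B : Set Plane}
    (hB : MeasurableSet B) (hfin : volume B ≠ ⊤) :
    P {ω | (Φ ω).count B = 1} =
      ENNReal.ofReal (lam * volume.real B * Real.exp (-lam * volume.real B)) := by
  have := hΦ.poisson B hB hfin.lt_top 1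
  rw [poissonMeasure_singleton, Real.coe_toNNReal _ (mul_nonneg hlam measureReal_nonneg)] at this
  simpa [mul_comm] using this

lemma measure_count_ne_zero_le [IsProbabilityMeasure P] (hΦ : IsHomogeneousPPP lam Φ P)
    (hlam : 0 ≤ lam) {B : Set Plane} (hB : MeasurableSet B) (hfin : volume B ≠ ⊤) :
    P {ω | (Φ ω).count B ≠ 0} ≤ ENNReal.ofReal (lam * volume.real B) := by
  have hm : MeasurableSet {ω | (Φ ω).count B = 0} :=
    hΦ.measurable (measurable_count hB (measurableSet_singleton 0))
  have hc : {ω | (Φ ω).count B ≠ 0} = {ω | (Φ ω).count B = 0}ᶜ := rfl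
  rw [hc, prob_compl_eq_one_sub hm, hΦ.measure_count_eq_zero hlam hB hfin, ← ENNReal.ofReal_one,
    ← ENNReal.ofReal_sub _ (Real.exp_pos _).le]
  refine ENNReal.ofReal_le_ofReal ?_
  have := Real.add_one_le_exp (-lam * volume.real B)
  linarith

lemma indepFun_count (hΦ : IsHomogeneousPPP lam Φ P) {A B : Set Plane} (hA : MeasurableSet A)
    (hB : MeasurableSet B) (hAB : Disjoint A B) :
    IndepFun (fun ω => (Φ ω).count A) (fun ω => (Φ ω).count B) P := by
  have := hΦ.indep 2 ![A, B] (by simp [Fin.forall_fin_two, hA, hB]) (by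
    intro i j hij
    fin_cases i <;> fin_cases j <;> simp_all [disjoint_comm])
  simpa using this.indepFun (show (0 : Fin 2) ≠ 1 by simp)

lemma measure_count_ne_zero_inter_le [IsProbabilityMeasure P] (hΦ : IsHomogeneousPPP lam Φ P)
    (hlam : 0 ≤ lam) {A B : Set Plane} (hA : MeasurableSet A) (hB : MeasurableSet B)
    (hAB : Disjoint A B) (hAf : volume A ≠ ⊤) (hBf : volume B ≠ ⊤) :
    P {ω | (Φ ω).count A ≠ 0 ∧ (Φ ω).count B = 0} ≤
      ENNReal.ofReal (lam * Real.exp (-lam * volume.real B)) * volume A := by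
  have h := (hΦ.indepFun_count hA hB hAB).measure_inter_preimage_eq_mul {0}ᶜ {0}
    (measurableSet_singleton 0).compl (measurableSet_singleton 0)
  calc _ = P {ω | (Φ ω).count A ≠ 0} * P {ω | (Φ ω).count B = 0} := h
    _ ≤ ENNReal.ofReal (lam * volume.real A) * ENNReal.ofReal (Real.exp (-lam * volume.real B)) :=
      mul_le_mul' (hΦ.measure_count_ne_zero_le hlam hA hAf)
        (hΦ.measure_count_eq_zero hlam hB hBf).le
    _ = _ := by
      rw [ENNReal.ofReal_mul hlam, ENNReal.ofReal_mul hlam, ofReal_measureReal hAf]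
      ring

/-- The two exponential factors combine to that of all of `B`, so the result is exactly linear in
the area of `A` and can be summed over cells into an integral. -/
lemma measure_count_eq_one_inter (hΦ : IsHomogeneousPPP lam Φ P)
    (hlam : 0 ≤ lam) {A B : Set Plane} (hA : MeasurableSet A) (hB : MeasurableSet B)
    (hAB : A ⊆ B) (hBf : volume B ≠ ⊤) :
    P {ω | (Φ ω).count A = 1 ∧ (Φ ω).count (B \ A) = 0} =
      ENNReal.ofReal (lam * Real.exp (-lam * volume.real B)) * volume A := by
  have hAf : volume A ≠ ⊤ := ((measure_mono hAB).trans_lt hBf.lt_top).ne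
  have hDf : volume (B \ A) ≠ ⊤ := ((measure_mono Set.sdiff_subset).trans_lt hBf.lt_top).ne
  have h := (hΦ.indepFun_count hA (hB.diff hA) Set.disjoint_sdiff_right).measure_inter_preimage_eq_mul
    {1} {0} (measurableSet_singleton 1) (measurableSet_singleton 0)
  calc _ = P {ω | (Φ ω).count A = 1} * P {ω | (Φ ω).count (B \ A) = 0} := h
    _ = _ := by
      rw [hΦ.measure_count_eq_one hlam hA hAf, hΦ.measure_count_eq_zero hlam (hB.diff hA) hDf,
        ← ENNReal.ofReal_mul (by positivity), mul_assoc (lam * _), ← Real.exp_add,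
        measureReal_sdiff hAB hA]
      conv_rhs => rw [← ofReal_measureReal hAf]
      rw [← ENNReal.ofReal_mul (by positivity)]
      congr 1
      rw [show -lam * volume.real A + -lam * (volume.real B - volume.real A) =
        -lam * volume.real B by ring]
      ring

end IsHomogeneousPPP

/-! ### Probability of a common nearest station -/

lemma lintegral_eq_tsum_cells {f : Plane → ℕ} (hf : Measurable f) (g : Plane → ENNReal) :
    ∫⁻ y, g y = ∑' i, ∫⁻ y in f ⁻¹' {i}, g y := by
  rw [← lintegral_iUnion (fun i => hf (measurableSet_singleton i)), ← Set.preimage_iUnion,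
    Set.iUnion_of_singleton, Set.preimage_univ, Measure.restrict_univ]
  intro i j hij
  exact Disjoint.preimage f (Set.disjoint_singleton.2 hij)

namespace IsHomogeneousPPP

variable {Ω : Type*} [MeasurableSpace Ω] {P : Measure Ω} {lam : ℝ} {Φ : Ω → PointConfig}

/-- A union bound over the cell containing the nearest station. Shrinking the discs by `δ` absorbs
the move to the cell centre, and by another `δ` the move to an arbitrary y of the cell. Removing the
cell loses area at most π δ², whence the extra exponential factor. -/
lemma measure_hasCommonNearest_le [IsProbabilityMeasure P] (hΦ : IsHomogeneousPPP lam Φ P)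
    (hlam : 0 ≤ lam) (a b : Plane) {δ : ℝ} (hδ : 0 < δ) :
    P {ω | (Φ ω).HasCommonNearest a b} ≤
      ∫⁻ y : Plane, ENNReal.ofReal (lam * Real.exp (lam * (Real.pi * δ ^ 2)) *
        Real.exp (-lam * volume.real (twoDiscs a b y (-(2 * δ))))) := by
  obtain ⟨f, c, hf, hc⟩ := exists_cells hδ
  set C : ℕ → Set Plane := fun i => f ⁻¹' {i} with hCdef
  have hC : ∀ i, MeasurableSet (C i) := fun i => hf (measurableSet_singleton i)
  have hCc : ∀ i, C i ⊆ Metric.closedBall (c i) δ := fun i z hz => by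
    have := hc z
    rwa [show f z = i from hz] at this
  have hCtop : ∀ i, volume (C i) ≠ ⊤ := fun i =>
    (Metric.isBounded_closedBall.subset (hCc i)).measure_lt_top.ne
  have hCvol : ∀ i, volume.real (C i) ≤ Real.pi * δ ^ 2 := fun i => by
    calc volume.real (C i) ≤ volume.real (Metric.closedBall (c i) δ) :=
          measureReal_mono (hCc i) Metric.isBounded_closedBall.measure_lt_top.ne
      _ = _ := by
          rw [measureReal_def, EuclideanSpace.volume_closedBall_fin_two, ENNReal.toReal_mul,
            ENNReal.toReal_pow, ENNReal.toReal_ofReal hδ.le, ENNReal.toReal_ofReal Real.pi_pos.le,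
            mul_comm]
  have hsub : {ω | (Φ ω).HasCommonNearest a b} ⊆
      ⋃ i, {ω | (Φ ω).count (C i) ≠ 0 ∧ (Φ ω).count (twoDiscs a b (c i) (-δ) \ C i) = 0} := by
    rintro ω ⟨y, hy, h⟩
    refine Set.mem_iUnion.2 ⟨f y, fun h0 => count_eq_zero.1 h0 y hy rfl,
      count_eq_zero.2 fun z hz hzD => ?_⟩
    have hne : z ≠ y := by
      rintro rfl
      exact hzD.2 rfl
    have hz' : z ∈ twoDiscs a b y 0 :=
      twoDiscs_subset (d := δ) (e := 0) (by rw [dist_comm]; exact hc y) (by simp) le_rfl (by simp)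
        hzD.1
    rw [mem_twoDiscs, add_zero, add_zero] at hz'
    obtain ⟨h1, h2⟩ := h z hz hne
    rcases hz' with h' | h' <;> linarith
  rw [lintegral_eq_tsum_cells hf]
  refine (measure_mono hsub).trans ((measure_iUnion_le _).trans (ENNReal.tsum_le_tsum fun i => ?_))
  have hDtop : volume (twoDiscs a b (c i) (-δ) \ C i) ≠ ⊤ :=
    ((isBounded_twoDiscs _ _ _ _).subset Set.sdiff_subset).measure_lt_top.ne
  refine (hΦ.measure_count_ne_zero_inter_le hlam (hC i) ((measurableSet_twoDiscs _ _ _ _).diff (hC i))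
    Set.disjoint_sdiff_right (hCtop i) hDtop).trans ?_
  rw [← setLIntegral_const]
  refine setLIntegral_mono' (hC i) fun y hy => ENNReal.ofReal_le_ofReal ?_
  rw [mul_assoc, ← Real.exp_add]
  refine mul_le_mul_of_nonneg_left (Real.exp_le_exp.2 ?_) hlam
  have h1 : volume.real (twoDiscs a b y (-(2 * δ))) ≤
      volume.real (twoDiscs a b (c i) (-δ) \ C i) + Real.pi * δ ^ 2 := by
    calc _ ≤ volume.real ((twoDiscs a b (c i) (-δ) \ C i) ∪ C i) := by
          refine measureReal_mono ?_ (measure_union_lt_top hDtop.lt_top (hCtop i).lt_top).ne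
          rw [Set.sdiff_union_self]
          exact (twoDiscs_subset (d := δ) (e := 0) (hCc i hy) (by simp) le_rfl
            (by linarith)).trans Set.subset_union_left
      _ ≤ _ := (measureReal_union_le _ _).trans (by linarith [hCvol i])
  have := mul_le_mul_of_nonneg_left h1 hlam
  linarith

/-- The isolation events of different cells are disjoint because a strictly nearest point is unique,
so their probabilities add up. The factor 1 matches `k` in `tendsto_lintegral_twoDiscs`. -/
lemma le_measure_hasCommonNearest (hΦ : IsHomogeneousPPP lam Φ P)
    (hlam : 0 ≤ lam) (a b : Plane) {δ : ℝ} (hδ : 0 < δ) :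
    ∫⁻ y : Plane, ENNReal.ofReal (lam * 1 *
        Real.exp (-lam * volume.real (twoDiscs a b y (3 * δ)))) ≤
      P {ω | (Φ ω).HasCommonNearest a b} := by
  obtain ⟨f, c, hf, hc⟩ := exists_cells hδ
  set C : ℕ → Set Plane := fun i => f ⁻¹' {i} with hCdef
  have hC : ∀ i, MeasurableSet (C i) := fun i => hf (measurableSet_singleton i)
  have hCc : ∀ i, C i ⊆ Metric.closedBall (c i) δ := fun i z hz => by
    have := hc z
    rwa [show f z = i from hz] at this
  have hCD : ∀ i, C i ⊆ twoDiscs a b (c i) (2 * δ) := fun i z hz => by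
    refine Or.inl ?_
    rw [Metric.mem_ball]
    have h1 := dist_triangle z (c i) a
    have h2 : dist z (c i) ≤ δ := hCc i hz
    linarith
  have hF : ∀ i ω, (Φ ω).IsolatedIn a b (c i) (2 * δ) (C i) → ∃ y ∈ (Φ ω).pts, y ∈ C i ∧
      ∀ z ∈ (Φ ω).pts, z ≠ y → dist y a < dist z a ∧ dist y b < dist z b := fun i ω h =>
    h.exists_nearest (hCc i) (b := b) (e := 0) (by simp) le_rfl (by linarith)
  have hsub : ⋃ i, {ω | (Φ ω).IsolatedIn a b (c i) (2 * δ) (C i)} ⊆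
      {ω | (Φ ω).HasCommonNearest a b} := by
    refine Set.iUnion_subset fun i ω h => ?_
    obtain ⟨y, hy, -, h⟩ := hF i ω h
    exact ⟨y, hy, h⟩
  refine le_trans ?_ (measure_mono hsub)
  rw [measure_iUnion, lintegral_eq_tsum_cells hf]
  · refine ENNReal.tsum_le_tsum fun i => ?_
    have := hΦ.measure_count_eq_one_inter hlam (hC i) (measurableSet_twoDiscs a b (c i) (2 * δ))
      (hCD i) (volume_twoDiscs_ne_top _ _ _ _)
    refine le_of_le_of_eq ?_ this.symm
    rw [← setLIntegral_const]
    refine setLIntegral_mono' (hC i) fun y hy => ENNReal.ofReal_le_ofReal ?_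
    rw [mul_one]
    refine mul_le_mul_of_nonneg_left (Real.exp_le_exp.2 ?_) hlam
    have h1 : volume.real (twoDiscs a b (c i) (2 * δ)) ≤ volume.real (twoDiscs a b y (3 * δ)) :=
      measureReal_mono (twoDiscs_subset (d := δ) (e := 0)
        (by rw [dist_comm]; exact hCc i hy) (by simp) le_rfl (by linarith))
        (volume_twoDiscs_ne_top _ _ _ _)
    have := mul_le_mul_of_nonneg_left h1 hlam
    linarith
  · intro i j hij
    refine Set.disjoint_left.2 fun ω hi hj => hij ?_
    obtain ⟨y, hy, hyi, h⟩ := hF i ω hi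
    obtain ⟨y', hy', hyj, h'⟩ := hF j ω hj
    have : y = y' := by
      by_contra hne
      exact (h y' hy' (Ne.symm hne)).1.not_gt (h' y hy hne).1
    subst this
    exact (show f y = i from hyi).symm.trans hyj
  · exact fun i => hΦ.measurable (measurableSet_isolatedIn _ _ _ _ (hC i))

/-- The probability that `a` and `b` have the same strictly nearest point. -/
theorem measure_hasCommonNearest [IsProbabilityMeasure P] (hΦ : IsHomogeneousPPP lam Φ P)
    (hlam : 0 < lam) (a b : Plane) :
    P {ω | (Φ ω).HasCommonNearest a b} =
      ∫⁻ y : Plane, ENNReal.ofReal (lam * Real.exp (-lam * volume.real (twoDiscs a b y 0))) := by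
  have hδ : ∀ n : ℕ, (0 : ℝ) < 1 / (n + 1) := fun n => by positivity
  have hδ1 : ∀ n : ℕ, (1 : ℝ) / (n + 1) ≤ 1 := fun n => by
    rw [div_le_one (by positivity)]
    linarith [(Nat.cast_nonneg n : (0 : ℝ) ≤ n)]
  have hlim := tendsto_one_div_add_atTop_nhds_zero_nat (𝕜 := ℝ)
  refine le_antisymm (ge_of_tendsto' (tendsto_lintegral_twoDiscs hlam a b
      (s := fun n => -(2 * (1 / ((n : ℝ) + 1))))
      (k := fun n => Real.exp (lam * (Real.pi * (1 / ((n : ℝ) + 1)) ^ 2)))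
      (K := Real.exp (lam * (Real.pi * 1 ^ 2))) ?_ ?_ ?_ ?_ ?_)
      fun n => hΦ.measure_hasCommonNearest_le hlam.le a b (hδ n))
    (le_of_tendsto' (tendsto_lintegral_twoDiscs hlam a b (s := fun n => 3 * (1 / ((n : ℝ) + 1)))
      (k := fun _ => 1) (K := 1) ?_ ?_ tendsto_const_nhds (fun _ => zero_le_one) (fun _ => le_rfl))
      fun n => hΦ.le_measure_hasCommonNearest hlam.le a b (hδ n))
  · simpa using (hlim.const_mul 2).neg
  · intro n
    linarith [hδ1 n]
  · have := ((hlim.pow 2).const_mul Real.pi).const_mul lam |>.rexp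
    simpa using this
  · exact fun n => (Real.exp_pos _).le
  · intro n
    have := hδ1 n
    have := (hδ n).le
    gcongr
  · simpa using hlim.const_mul 3
  · intro n
    linarith [hδ n]

/-- Almost surely, a given location has a unique nearest point. -/
theorem measure_hasCommonNearest_self [IsProbabilityMeasure P] (hΦ : IsHomogeneousPPP lam Φ P)
    (hlam : 0 < lam) (a : Plane) : P {ω | (Φ ω).HasCommonNearest a a} = 1 := by
  have hc : 0 < lam * Real.pi := by positivity
  -- For coinciding locations the two discs are one, and the formula becomes a Gaussian integral of
  -- total mass 1.
  have hv : ∀ y, -lam * volume.real (twoDiscs a a y 0) = -(lam * Real.pi) * dist y a ^ 2 :=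
    fun y => by
      rw [twoDiscs, Set.union_self, volume_real_ball, add_zero, max_eq_left dist_nonneg]
      ring
  rw [hΦ.measure_hasCommonNearest hlam]
  simp only [hv]
  rw [← ofReal_integral_eq_lintegral_ofReal ((integrable_exp_neg_mul_dist_sq hc a).const_mul lam)
    (Filter.Eventually.of_forall fun y => by positivity), integral_const_mul]
  simp only [dist_eq_norm]
  rw [integral_sub_right_eq_self (fun y : Plane => Real.exp (-(lam * Real.pi) * ‖y‖ ^ 2)),
    GaussianFourier.integral_rexp_neg_mul_sq_norm hc]
  simp only [finrank_euclideanSpace, Fintype.card_fin, Nat.cast_ofNat]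
  rw [div_self two_ne_zero, Real.rpow_one, ← ENNReal.ofReal_one]
  congr 1
  field_simp

end IsHomogeneousPPP

/-! ### Area of the union of two discs -/

/-- Substituting x = r cos u with u from π to φ, where sin u ≥ 0, leaves a multiple of sin² u. -/
lemma integral_two_mul_sqrt_sq_sub_sq {r φ : ℝ} (hr : 0 ≤ r) (h0 : 0 ≤ φ) (hπ : φ ≤ Real.pi) :
    ∫ x in (-r)..(r * Real.cos φ), 2 * √(r ^ 2 - x ^ 2) =
      r ^ 2 * (Real.pi - φ + 1 / 2 * Real.sin (2 * φ)) := by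
  have hsub := intervalIntegral.integral_comp_mul_deriv (a := Real.pi) (b := φ)
    (f := fun u => r * Real.cos u) (f' := fun u => r * -Real.sin u)
    (g := fun x => 2 * √(r ^ 2 - x ^ 2))
    (fun u _ => (Real.hasDerivAt_cos u).const_mul r) (by fun_prop) (by fun_prop)
  rw [Real.cos_pi, mul_neg_one] at hsub
  rw [← hsub]
  have hcongr : ∫ u in Real.pi..φ,
        ((fun x => 2 * √(r ^ 2 - x ^ 2)) ∘ fun u => r * Real.cos u) u * (r * -Real.sin u) =
      ∫ u in Real.pi..φ, (-(2 * r ^ 2)) * Real.sin u ^ 2 := by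
    refine intervalIntegral.integral_congr fun u hu => ?_
    rw [Set.uIcc_of_ge hπ] at hu
    have hs : 0 ≤ Real.sin u := Real.sin_nonneg_of_nonneg_of_le_pi (h0.trans hu.1) hu.2
    have : r ^ 2 - (r * Real.cos u) ^ 2 = (r * Real.sin u) ^ 2 := by
      rw [mul_pow, mul_pow, Real.sin_sq]
      ring
    simp only [Function.comp_apply]
    rw [this, Real.sqrt_sq (mul_nonneg hr hs)]
    ring
  rw [hcongr, intervalIntegral.integral_const_mul, integral_sin_sq, Real.sin_pi, Real.sin_two_mul]
  ring

/-- The area of a disc cut off by a vertical line. -/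
lemma Complex.volume_disc_inter_halfPlane {r φ : ℝ} (hr : 0 ≤ r) (h0 : 0 ≤ φ) (hπ : φ ≤ Real.pi)
    {s : Set ℝ} (hs : MeasurableSet s) (hsae : s =ᵐ[volume] Set.Ioc (-r) (r * Real.cos φ)) :
    volume {z : ℂ | z.re ∈ s ∧ ‖z‖ < r} =
      ENNReal.ofReal (r ^ 2 * (Real.pi - φ + 1 / 2 * Real.sin (2 * φ))) := by
  have hset : {z : ℂ | z.re ∈ s ∧ ‖z‖ < r} = Complex.measurableEquivRealProd ⁻¹'
      (regionBetween (fun x => -√(r ^ 2 - x ^ 2)) (fun x => √(r ^ 2 - x ^ 2)) s) := by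
    ext z
    simp only [regionBetween, Set.mem_preimage, Set.mem_ofPred_eq,
      Complex.measurableEquivRealProd_apply, Set.mem_Ioo, ← abs_lt]
    refine and_congr_right fun _ => ?_
    rw [Real.lt_sqrt (abs_nonneg _), sq_abs, ← Complex.sq_norm_sub_sq_re, sub_lt_sub_iff_right,
      sq_lt_sq₀ (norm_nonneg _) hr]
  have hle : -r ≤ r * Real.cos φ := by
    nlinarith [Real.neg_one_le_cos φ]
  have hcont : Continuous fun x : ℝ => √(r ^ 2 - x ^ 2) := by fun_prop
  have hint : IntegrableOn (fun x : ℝ => √(r ^ 2 - x ^ 2)) s :=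
    ((hcont.integrableOn_Icc (a := -r) (b := r * Real.cos φ)).mono_set
      Set.Ioc_subset_Icc_self).congr_set_ae hsae
  have hneg : IntegrableOn (fun x : ℝ => -√(r ^ 2 - x ^ 2)) s := hint.neg
  rw [hset, Complex.volume_preserving_equiv_real_prod.measure_preimage_equiv,
    Measure.volume_eq_prod, volume_regionBetween_eq_integral hneg hint hs
      (fun x _ => by linarith [Real.sqrt_nonneg (r ^ 2 - x ^ 2)]),
    setIntegral_congr_set hsae, ← intervalIntegral.integral_of_le hle,
    ← integral_two_mul_sqrt_sq_sub_sq hr h0 hπ]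
  congr 2
  ext x
  simp only [Pi.sub_apply]
  ring

/-- This includes r = 0, where x = 0 too; hence the area formula needs no exception when z is one of
the centres. -/
lemma mul_cos_arccos_div {x r : ℝ} (h : |x| ≤ r) : r * Real.cos (Real.arccos (x / r)) = x := by
  rcases ((abs_nonneg x).trans h).eq_or_lt with h0 | h0
  · rw [← h0] at h ⊢
    simpa using (abs_nonpos_iff.1 h).symm
  · obtain ⟨h1, h2⟩ := abs_le.1 h
    rw [Real.cos_arccos ((le_div_iff₀ h0).2 (by linarith)) ((div_le_one h0).2 h2)]
    field_simp

/-- The area of the union of two discs whose boundary circles meet in `z`. -/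
lemma Complex.volume_real_ball_union_ball {d : ℝ} (hd : 0 < d) (z : ℂ) :
    volume.real (Metric.ball 0 ‖z‖ ∪ Metric.ball (d : ℂ) ‖z - d‖) =
      ‖z‖ ^ 2 * (Real.pi - Real.arccos (z.re / ‖z‖) +
        1 / 2 * Real.sin (2 * Real.arccos (z.re / ‖z‖))) +
      ‖z - d‖ ^ 2 * (Real.pi - Real.arccos ((d - z.re) / ‖z - d‖) +
        1 / 2 * Real.sin (2 * Real.arccos ((d - z.re) / ‖z - d‖))) := by
  have e1 := mul_cos_arccos_div (Complex.abs_re_le_norm z)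
  have e2 : ‖z - d‖ * Real.cos (Real.arccos ((d - z.re) / ‖z - d‖)) = d - z.re :=
    mul_cos_arccos_div (by
      have := Complex.abs_re_le_norm (z - d)
      rwa [Complex.sub_re, Complex.ofReal_re, abs_sub_comm] at this)
  -- Since ‖w‖² - ‖w - d‖² depends only on Re w and increases with it, the first disc contains the
  -- second to the left of the vertical line through z, and conversely to the right. The right part
  -- is reflected by w ↦ d - w to become a left segment; the line itself goes to the first piece.
  have hset : Metric.ball 0 ‖z‖ ∪ Metric.ball (d : ℂ) ‖z - d‖ =
      {w : ℂ | w.re ∈ Set.Ioc (-‖z‖) z.re ∧ ‖w‖ < ‖z‖} ∪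
      (fun w => (d : ℂ) - w) ⁻¹' {w : ℂ | w.re ∈ Set.Ioo (-‖z - d‖) (d - z.re) ∧ ‖w‖ < ‖z - d‖} := by
    have hn : ∀ w : ℂ, ‖w - d‖ ^ 2 = ‖w‖ ^ 2 - 2 * d * w.re + d ^ 2 := fun w => by
      rw [Complex.sq_norm, Complex.sq_norm, Complex.normSq_apply, Complex.normSq_apply]
      simp
      ring
    ext w
    have h1 := abs_le.1 (Complex.abs_re_le_norm w)
    have h2 := abs_le.1 (Complex.abs_re_le_norm (d - w))
    simp only [Complex.sub_re, Complex.ofReal_re] at h2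
    have h3 := hn w
    have h4 := hn z
    simp only [Set.mem_union, Metric.mem_ball, dist_eq_norm, sub_zero, Set.mem_ofPred_eq,
      Set.mem_preimage, Complex.sub_re, Complex.ofReal_re, Set.mem_Ioc, Set.mem_Ioo]
    rw [norm_sub_rev (d : ℂ) w] at h2 ⊢
    rcases le_or_gt w.re z.re with hle | hlt
    · have himp : ‖w - d‖ < ‖z - d‖ → ‖w‖ < ‖z‖ := by
        intro h
        rw [← sq_lt_sq₀ (norm_nonneg _) (norm_nonneg _)] at h ⊢
        nlinarith
      constructor
      · intro h
        have h : ‖w‖ < ‖z‖ := h.elim id himp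
        exact Or.inl ⟨⟨by linarith, hle⟩, h⟩
      · rintro (h | h)
        · exact Or.inl h.2
        · exact Or.inr h.2
    · have himp : ‖w‖ < ‖z‖ → ‖w - d‖ < ‖z - d‖ := by
        intro h
        rw [← sq_lt_sq₀ (norm_nonneg _) (norm_nonneg _)] at h ⊢
        nlinarith
      constructor
      · intro h
        have h : ‖w - d‖ < ‖z - d‖ := h.elim himp id
        exact Or.inr ⟨⟨by linarith, by linarith⟩, h⟩
      · rintro (h | h)
        · exact Or.inl h.2
        · exact Or.inr h.2
  have hm : ∀ (s : Set ℝ) (r : ℝ), MeasurableSet s → MeasurableSet {w : ℂ | w.re ∈ s ∧ ‖w‖ < r} :=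
    fun s r hs => (Complex.measurable_re hs).inter (measurableSet_lt measurable_norm measurable_const)
  have hmp : MeasurePreserving (fun w => (d : ℂ) - w) := Measure.measurePreserving_sub_left volume _
  have hdisj : Disjoint {w : ℂ | w.re ∈ Set.Ioc (-‖z‖) z.re ∧ ‖w‖ < ‖z‖}
      ((fun w => (d : ℂ) - w) ⁻¹'
        {w : ℂ | w.re ∈ Set.Ioo (-‖z - d‖) (d - z.re) ∧ ‖w‖ < ‖z - d‖}) := by
    refine Set.disjoint_left.2 fun w hw hw' => ?_
    have h1 := hw.1.2
    have h2 := hw'.1.2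
    simp only [Complex.sub_re, Complex.ofReal_re] at h2
    linarith
  have hnn : ∀ {r φ : ℝ}, 0 ≤ φ → φ ≤ Real.pi →
      0 ≤ r ^ 2 * (Real.pi - φ + 1 / 2 * Real.sin (2 * φ)) := by
    intro r φ h0 hπ
    have h := integral_two_mul_sqrt_sq_sub_sq (abs_nonneg r) h0 hπ
    rw [sq_abs] at h
    rw [← h]
    refine intervalIntegral.integral_nonneg ?_ fun x _ => by positivity
    nlinarith [Real.neg_one_le_cos φ, abs_nonneg r]
  rw [measureReal_def, hset, measure_union hdisj ((hm _ _ measurableSet_Ioo).preimage hmp.measurable),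
    hmp.measure_preimage (hm _ _ measurableSet_Ioo).nullMeasurableSet,
    Complex.volume_disc_inter_halfPlane (norm_nonneg z) (Real.arccos_nonneg (z.re / ‖z‖))
      (Real.arccos_le_pi _) measurableSet_Ioc (by rw [e1]; exact ae_eq_refl _),
    Complex.volume_disc_inter_halfPlane (norm_nonneg (z - d))
      (Real.arccos_nonneg ((d - z.re) / ‖z - d‖)) (Real.arccos_le_pi _) measurableSet_Ioo
      (by rw [e2]; exact Ioo_ae_eq_Ioc),
    ← ENNReal.ofReal_add (hnn (Real.arccos_nonneg _) (Real.arccos_le_pi _))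
      (hnn (Real.arccos_nonneg _) (Real.arccos_le_pi _)), ENNReal.toReal_ofReal]
  exact add_nonneg (hnn (Real.arccos_nonneg _) (Real.arccos_le_pi _))
      (hnn (Real.arccos_nonneg _) (Real.arccos_le_pi _))

/-! ### Isotropy and polar coordinates -/

/-- The handover integrand in terms of the area of the union of two discs in the complex plane. -/
lemma handoverIntegrand_eq {lam v t r θ : ℝ} (hv : 0 < v) (ht : 0 < t) (hr : 0 < r) {z : ℂ}
    (hz : z = r * (Real.cos θ + Real.sin θ * Complex.I)) :
    handoverIntegrand lam v t r θ = 2 * Real.pi * (r * (lam * Real.exp (-lam *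
      volume.real (Metric.ball 0 ‖z‖ ∪ Metric.ball ((v * t : ℝ) : ℂ) ‖z - (v * t : ℝ)‖)))) := by
  have hre : z.re = r * Real.cos θ := by rw [hz]; simp [-Complex.ofReal_cos, -Complex.ofReal_sin]
  have him : z.im = r * Real.sin θ := by rw [hz]; simp [-Complex.ofReal_cos, -Complex.ofReal_sin]
  have hsc := Real.sin_sq_add_cos_sq θ
  have hnorm : ‖z‖ = r := by
    rw [← sq_eq_sq₀ (norm_nonneg _) hr.le, Complex.sq_norm, Complex.normSq_apply, hre, him]
    linear_combination r ^ 2 * hsc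
  have hsq : ‖z - (v * t : ℝ)‖ ^ 2 = r ^ 2 + v ^ 2 * t ^ 2 - 2 * r * v * t * Real.cos θ := by
    rw [Complex.sq_norm, Complex.normSq_apply, Complex.sub_re, Complex.sub_im, Complex.ofReal_re,
      Complex.ofReal_im, hre, him]
    linear_combination r ^ 2 * hsc
  have hR : handoverR v t r θ = ‖z - (v * t : ℝ)‖ := by
    rw [handoverR, ← hsq, Real.sqrt_sq (norm_nonneg _)]
  have h1 : handoverPhi₁ v t r θ = Real.arccos (z.re / ‖z‖) := by
    rw [handoverPhi₁, hR, hsq, hre, hnorm]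
    congr 1
    field_simp
    ring
  have h2 : handoverPhi₂ v t r θ = Real.arccos ((v * t - z.re) / ‖z - (v * t : ℝ)‖) := by
    rw [handoverPhi₂, hR, show v ^ 2 * t ^ 2 + ‖z - (v * t : ℝ)‖ ^ 2 - r ^ 2 =
      (2 * v * t) * (v * t - z.re) by rw [hsq, hre]; ring, mul_div_mul_left _ _ (by positivity)]
  rw [handoverIntegrand, h1, h2, hR, Complex.volume_real_ball_union_ball (mul_pos hv ht), hnorm]
  ring

/-- The integral over the plane equals, by isotropy, a double integral in polar coordinates. -/
lemma lintegral_twoDiscs_eq (lam : ℝ) (p : Plane) {v t : ℝ} (hv : 0 < v) (ht : 0 < t)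
    (θ₀ : ℝ) :
    ENNReal.ofReal (2 * Real.pi) * ∫⁻ y : Plane, ENNReal.ofReal (lam * Real.exp
        (-lam * volume.real (twoDiscs p (uePosition p v θ₀ t) y 0))) =
      ∫⁻ q in Set.Ioi (0 : ℝ) ×ˢ Set.Ioc (0 : ℝ) (2 * Real.pi),
        ENNReal.ofReal (handoverIntegrand lam v t q.1 q.2) := by
  -- The isometry z ↦ p + U z takes 0 to p and the positive real axis to the ray of motion.
  set U : ℂ ≃ₗᵢ[ℝ] Plane :=
    (rotation (Circle.exp θ₀)).trans Complex.orthonormalBasisOneI.repr with hU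
  have hUd : uePosition p v θ₀ t = p + U ((v * t : ℝ) : ℂ) := by
    rw [uePosition, hU]
    congr 1
    ext i
    fin_cases i <;> simp [Complex.orthonormalBasisOneI_repr_apply, rotation_apply, Circle.coe_exp,
      Complex.exp_re, Complex.exp_im, mul_comm]
  set G : ℂ → ENNReal := fun z => ENNReal.ofReal (lam * Real.exp (-lam *
    volume.real (Metric.ball 0 ‖z‖ ∪ Metric.ball ((v * t : ℝ) : ℂ) ‖z - (v * t : ℝ)‖))) with hG
  have hmp : MeasurePreserving (fun z : ℂ => p + U z) :=
    (measurePreserving_add_left volume p).comp U.measurePreserving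
  have hvol : ∀ z : ℂ, volume.real (twoDiscs p (uePosition p v θ₀ t) (p + U z) 0) =
      volume.real (Metric.ball 0 ‖z‖ ∪ Metric.ball ((v * t : ℝ) : ℂ) ‖z - (v * t : ℝ)‖) := fun z => by
    rw [measureReal_def, ← hmp.measure_preimage (measurableSet_twoDiscs _ _ _ _).nullMeasurableSet,
      ← measureReal_def]
    congr 1
    ext w
    rw [Set.mem_preimage, mem_twoDiscs, hUd]
    simp only [add_zero, dist_add_left, LinearIsometryEquiv.dist_map, dist_self_add_left,
      LinearIsometryEquiv.norm_map, Set.mem_union, Metric.mem_ball]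
    simp only [dist_eq_norm, sub_zero]
  have hplane : ∫⁻ y : Plane, ENNReal.ofReal (lam * Real.exp
        (-lam * volume.real (twoDiscs p (uePosition p v θ₀ t) y 0))) = ∫⁻ z : ℂ, G z := by
    rw [← hmp.lintegral_comp]
    · simp only [hvol, hG]
    · have := measurable_volume_twoDiscs p (uePosition p v θ₀ t) 0
      fun_prop
  have hae : (Set.Ioi (0 : ℝ) ×ˢ Set.Ioc (0 : ℝ) (2 * Real.pi) : Set (ℝ × ℝ)) =ᵐ[volume]
      (Set.Ioi (0 : ℝ) ×ˢ Set.Ioo (0 : ℝ) (2 * Real.pi) : Set (ℝ × ℝ)) := by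
    rw [Measure.volume_eq_prod]
    exact Measure.set_prod_ae_eq (Filter.EventuallyEq.refl _ _) Ioo_ae_eq_Ioc.symm
  -- Polar coordinates use angles in (-π, π), the formula those in (0, 2π]. The shift by π is
  -- compensated by z ↦ -z, which preserves the integral over the plane.
  have hshift : MeasurePreserving (fun q : ℝ × ℝ => q + (0, Real.pi)) :=
    measurePreserving_add_right volume _
  have hpre : (fun q : ℝ × ℝ => q + (0, Real.pi)) ⁻¹'
      (Set.Ioi (0 : ℝ) ×ˢ Set.Ioo (0 : ℝ) (2 * Real.pi)) = polarCoord.target := by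
    ext q
    simp only [Set.mem_preimage, Set.mem_prod, Prod.fst_add, Prod.snd_add, add_zero, Set.mem_Ioi,
      Set.mem_Ioo, polarCoord_target]
    refine and_congr_right fun _ => ⟨fun h => ⟨by linarith, by linarith⟩,
      fun h => ⟨by linarith, by linarith⟩⟩
  have hpull := hshift.setLIntegral_comp_preimage_emb
    (MeasurableEquiv.addRight ((0 : ℝ), Real.pi)).measurableEmbedding
    (fun q => ENNReal.ofReal (handoverIntegrand lam v t q.1 q.2))
    (Set.Ioi (0 : ℝ) ×ˢ Set.Ioo (0 : ℝ) (2 * Real.pi))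
  rw [hplane, ← lintegral_neg_eq_self, ← Complex.lintegral_comp_polarCoord_symm, setLIntegral_congr hae,
    ← hpull, hpre, ← lintegral_const_mul' _ _ ENNReal.ofReal_ne_top]
  refine setLIntegral_congr_fun polarCoord.open_target.measurableSet fun q hq => ?_
  have hr : 0 < q.1 := by
    rw [polarCoord_target] at hq
    exact hq.1
  simp only [Prod.fst_add, Prod.snd_add, add_zero]
  rw [handoverIntegrand_eq hv ht hr (z := -(Complex.polarCoord.symm q))
    (by rw [Complex.polarCoord_symm_apply, Real.cos_add_pi, Real.sin_add_pi]; push_cast; ring),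
    ENNReal.ofReal_mul (p := 2 * Real.pi) (by positivity), ENNReal.ofReal_mul hr.le, smul_eq_mul]

lemma measurable_handoverIntegrand (lam v t : ℝ) :
    Measurable fun q : ℝ × ℝ => handoverIntegrand lam v t q.1 q.2 := by
  have hR : Measurable fun q : ℝ × ℝ => handoverR v t q.1 q.2 := by
    unfold handoverR
    fun_prop
  have h1 : Measurable fun q : ℝ × ℝ => handoverPhi₁ v t q.1 q.2 :=
    Real.measurable_arccos.comp (by fun_prop)
  have h2 : Measurable fun q : ℝ × ℝ => handoverPhi₂ v t q.1 q.2 :=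
    Real.measurable_arccos.comp (by fun_prop)
  unfold handoverIntegrand
  fun_prop

lemma measurable_uePosition (p : Plane) (v t : ℝ) : Measurable fun θ => uePosition p v θ t := by
  have : Continuous fun θ => uePosition p v θ t := by
    unfold uePosition
    fun_prop
  exact this.measurable

/-! ### Random direction and the handover event -/

section

variable {Ω : Type*} [MeasurableSpace Ω] {P : Measure Ω} {lam : ℝ}
  {Φ : Ω → PointConfig} {Θ : Ω → ℝ}

lemma measurableSet_commonNearest_uePosition (hΦ : IsHomogeneousPPP lam Φ P) (hΘ : Measurable Θ)
    (p : Plane) (v t : ℝ) :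
    MeasurableSet {ω | (Φ ω).HasCommonNearest p (uePosition p v (Θ ω) t)} :=
  (((measurable_uePosition p v t).comp hΘ).prodMk hΦ.measurable)
    (measurableSet_hasCommonNearest p)

/-- Up to a null set, no handover occurs iff the initial and the final position have the same
strictly nearest station. -/
lemma handoverEvent_ae_eq [IsProbabilityMeasure P] (hΦ : IsHomogeneousPPP lam Φ P)
    (hlam : 0 < lam) (p : Plane) (v : ℝ) {t : ℝ} (ht : 0 < t) :
    handoverEvent Φ Θ p v t =ᵐ[P]
      ({ω | (Φ ω).HasCommonNearest p (uePosition p v (Θ ω) t)}ᶜ : Set Ω) := by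
  have hself : ∀ᵐ ω ∂P, (Φ ω).HasCommonNearest p p := by
    have hm : MeasurableSet {ω | (Φ ω).HasCommonNearest p p} :=
      (measurable_const.prodMk hΦ.measurable) (measurableSet_hasCommonNearest p)
    exact (prob_compl_eq_zero_iff hm).2 (hΦ.measure_hasCommonNearest_self hlam p)
  rw [Filter.eventuallyEq_set]
  filter_upwards [hself] with ω hω
  rw [Set.mem_compl_iff]
  constructor
  · rintro ⟨s, hs, hst, hne⟩ h
    exact hne (h.serving_uePosition_eq hs hst.le)
  · intro h
    -- Time 0 already witnesses the handover: equal serving sets at both ends would give a common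
    -- nearest station.
    refine ⟨0, le_rfl, ht, fun heq => h ?_⟩
    have h0 : uePosition p v (Θ ω) 0 = p := by simp [uePosition]
    rw [h0] at heq
    exact hasCommonNearest_of_serving_eq hω heq

/-- By isotropy of the process, the conditional probability given the direction does not depend on
the direction; only independence of the direction matters, not its law. -/
lemma measure_commonNearest_uePosition [IsProbabilityMeasure P]
    (hΦ : IsHomogeneousPPP lam Φ P) (hlam : 0 < lam) (hΘ : Measurable Θ)
    (hindep : IndepFun Θ Φ P) (p : Plane) {v t : ℝ} (hv : 0 < v) (ht : 0 < t) :
    ENNReal.ofReal (2 * Real.pi) *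
        P {ω | (Φ ω).HasCommonNearest p (uePosition p v (Θ ω) t)} =
      ∫⁻ q in Set.Ioi (0 : ℝ) ×ˢ Set.Ioc (0 : ℝ) (2 * Real.pi),
        ENNReal.ofReal (handoverIntegrand lam v t q.1 q.2) := by
  have hG : MeasurableSet {q : ℝ × PointConfig | q.2.HasCommonNearest p (uePosition p v q.1 t)} :=
    (((measurable_uePosition p v t).comp measurable_fst).prodMk measurable_snd)
      (measurableSet_hasCommonNearest p)
  have hprob := Measure.isProbabilityMeasure_map (μ := P) hΘ.aemeasurable
  have hprob' := Measure.isProbabilityMeasure_map (μ := P) hΦ.measurable.aemeasurable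
  have hlaw := (indepFun_iff_map_prod_eq_prod_map_map hΘ.aemeasurable
    hΦ.measurable.aemeasurable).1 hindep
  -- Conditioning on the direction: the joint law is a product, so Tonelli applies to the jointly
  -- measurable event.
  have hA : P {ω | (Φ ω).HasCommonNearest p (uePosition p v (Θ ω) t)} =
      ∫⁻ θ, P {ω | (Φ ω).HasCommonNearest p (uePosition p v θ t)} ∂(P.map Θ) := by
    have h1 := Measure.map_apply (μ := P) (hΘ.prodMk hΦ.measurable) hG
    rw [hlaw, Measure.prod_apply hG] at h1
    refine h1.symm.trans (lintegral_congr fun θ => ?_)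
    exact Measure.map_apply hΦ.measurable (hG.preimage measurable_prodMk_left)
  rw [hA, ← lintegral_const_mul' _ _ ENNReal.ofReal_ne_top]
  simp only [hΦ.measure_hasCommonNearest hlam, lintegral_twoDiscs_eq lam p hv ht]
  rw [lintegral_const, measure_univ, mul_one]

end

theorem theorem2 {Ω : Type*} [MeasurableSpace Ω] (P : Measure Ω) [IsProbabilityMeasure P]
    (lam : ℝ) (hlam : 0 < lam)
    (Φ : Ω → PointConfig) (hΦ : IsHomogeneousPPP lam Φ P)
    (Θ : Ω → ℝ) (hΘ : Measurable Θ)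
    (hΘunif : pdf.IsUniform Θ (Set.Ico 0 (2 * Real.pi)) P volume)
    (hindep : IndepFun Θ Φ P)
    (p : Plane) (v t : ℝ) (hv : 0 < v) (ht : 0 < t) :
    NullMeasurableSet (handoverEvent Φ Θ p v t) P ∧
    IntegrableOn (fun q : ℝ × ℝ => handoverIntegrand lam v t q.1 q.2)
      (Set.Ioi 0 ×ˢ Set.Ioc 0 (2 * Real.pi)) ∧
    P.real (handoverEvent Φ Θ p v t) =
      1 - 1 / (2 * Real.pi) * ∫ r in Set.Ioi (0 : ℝ), ∫ θ in (0 : ℝ)..(2 * Real.pi),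
        handoverIntegrand lam v t r θ := by
  have hm := measurableSet_commonNearest_uePosition hΦ hΘ p v t
  have hae := handoverEvent_ae_eq (Θ := Θ) hΦ hlam p v ht
  have hP := measure_commonNearest_uePosition hΦ hlam hΘ hindep p hv ht
  have hmeas : AEStronglyMeasurable (fun q : ℝ × ℝ => handoverIntegrand lam v t q.1 q.2)
      (volume.restrict (Set.Ioi 0 ×ˢ Set.Ioc 0 (2 * Real.pi))) :=
    (measurable_handoverIntegrand lam v t).aestronglyMeasurable
  have hnn : 0 ≤ᵐ[volume.restrict (Set.Ioi 0 ×ˢ Set.Ioc 0 (2 * Real.pi))]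
      fun q : ℝ × ℝ => handoverIntegrand lam v t q.1 q.2 := by
    filter_upwards [ae_restrict_mem (measurableSet_Ioi.prod measurableSet_Ioc)] with q hq
    have hr : 0 < q.1 := hq.1
    simp only [Pi.zero_apply, handoverIntegrand]
    positivity
  have hint : IntegrableOn (fun q : ℝ × ℝ => handoverIntegrand lam v t q.1 q.2)
      (Set.Ioi 0 ×ˢ Set.Ioc 0 (2 * Real.pi)) := by
    -- The integral of the nonnegative integrand is 2π times a probability, hence finite.
    rw [IntegrableOn, ← lintegral_ofReal_ne_top_iff_integrable hmeas hnn, ← hP]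
    exact ENNReal.mul_ne_top ENNReal.ofReal_ne_top (measure_ne_top _ _)
  refine ⟨hm.compl.nullMeasurableSet.congr hae.symm, hint, ?_⟩
  have hI : ∫ r in Set.Ioi (0 : ℝ), ∫ θ in (0 : ℝ)..(2 * Real.pi), handoverIntegrand lam v t r θ =
      2 * Real.pi * P.real {ω | (Φ ω).HasCommonNearest p (uePosition p v (Θ ω) t)} := by
    simp only [intervalIntegral.integral_of_le Real.two_pi_pos.le]
    rw [Measure.volume_eq_prod] at hint
    rw [← setIntegral_prod (fun q : ℝ × ℝ => handoverIntegrand lam v t q.1 q.2) hint,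
      ← Measure.volume_eq_prod, integral_eq_lintegral_of_nonneg_ae hnn hmeas, ← hP,
      ENNReal.toReal_mul, ENNReal.toReal_ofReal Real.two_pi_pos.le, measureReal_def]
  rw [hI, measureReal_congr hae, probReal_compl_eq_one_sub hm]
  field_simp
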